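/- Let $n\ge 1$. An $n$-dimensional special datum $\mathbb D=(D,w)$ consists of a set $D$ of non-empty subsets of $\{1,\dots,n\}$ and a function $w:D\to\mathbb N$ such that: (1) $\{i\}\in D$ for every $i\in\{1,\dots,n\}$; (2) for all $J,J'\in D$, either $J\subset J'$, or $J'\subset J$, or $J\cap J'=\emptyset$; (3) $w(J)=1$ for every element $J$ of $D$ that is maximal with respect to inclusion; (4) if $J,J'\in D$ and $J\subsetneq J'$, then $w(J)>w(J')$ and $w(J')\mid w(J)$; (5) if $J_1,J_2,J\in D$ with $J_1\sqsubset J$ and $J_2\sqsubset J$, then $w(J_1)=w(J_2)$, where $J'\sqsubset J$ means that $J'\subsetneq J$ and no $K\in D$ satisfies $J'\subsetneq K\subsetneq J$. For such a datum put $x_J=\prod_{j\in J}x_j$, let $R_{\mathbb D}=\mathbb C[x_J^{w(J)}\mid J\in D]\subset\mathbb C[x_1,\dots,x_n]$, and let $\mathfrak m_{\mathbb D}=(x_J^{w(J)}\mid J\in D)$, a maximal ideal of $R_{\mathbb D}$. Let $e(R_{\mathbb D})$ and $\mathrm{emb}(R_{\mathbb D})$ denote the Hilbert–Samuel multiplicity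 and the embedding dimension of the local ring $A=(R_{\mathbb D})_{\mathfrak m_{\mathbb D}}$ with maximal ideal $\mathfrak m$; that is, $e(R_{\mathbb D})=\lim_{k\to\infty}d!\,\ell_A(A/\mathfrak m^k)/k^d$ with $d=\dim A$, and $\mathrm{emb}(R_{\mathbb D})=\dim_{A/\mathfrak m}\mathfrak m/\mathfrak m^2$. Then for every $n$-dimensional special datum $\mathbb D$ the limit defining $e(R_{\mathbb D})$ exists, $$e(R_{\mathbb D})\le 2^{n-1},$$ and equality holds if and only if $\mathrm{emb}(R_{\mathbb D})=2n-1$. -/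

import Mathlib

open Filter Topology

noncomputable section

/-- The normalized Hilbert–Samuel function `k ↦ d! · ℓ_A(A / 𝔪 ^ k) / k ^ d` of a local ring
`(A, 𝔪)`, where `d` is the Krull dimension of `A`. -/
def normalizedHilbertSamuel (A : Type*) [CommRing A] [IsLocalRing A] (k : ℕ) : ℝ :=
  let d : ℕ := ((ringKrullDim A).unbotD 0).toNat
  (d.factorial : ℝ) *
      ((Module.length A (A ⧸ IsLocalRing.maximalIdeal A ^ k)).toNat : ℝ) / (k : ℝ) ^ d

/-- The Hilbert–Samuel multiplicity `lim_{k → ∞} d! · ℓ_A(A / 𝔪 ^ k) / k ^ d` of a local ring. -/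
def hilbertSamuelMultiplicity (A : Type*) [CommRing A] [IsLocalRing A] : ℝ :=
  limUnder atTop (normalizedHilbertSamuel A)

/-- The embedding dimension of a local ring: the dimension of `𝔪 / 𝔪 ^ 2` over the residue
field. -/
def embeddingDimension (A : Type*) [CommRing A] [IsLocalRing A] : ℕ :=
  Module.finrank (IsLocalRing.ResidueField A) (IsLocalRing.CotangentSpace A)

/-- An `n`-dimensional special datum. The index set `{1, …, n}` is `Fin n`. The weight is a total
function on subsets, of which only the values on members of `D` are ever used. -/
structure SpecialDatum (n : ℕ) where
  D : Finset (Finset (Fin n))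
  w : Finset (Fin n) → ℕ
  nonempty_of_mem : ∀ J ∈ D, J.Nonempty
  singleton_mem : ∀ i : Fin n, {i} ∈ D
  laminar : ∀ J ∈ D, ∀ J' ∈ D, J ⊆ J' ∨ J' ⊆ J ∨ Disjoint J J'
  w_maximal : ∀ J, Maximal (· ∈ D) J → w J = 1
  w_lt : ∀ J ∈ D, ∀ J' ∈ D, J ⊂ J' → w J' < w J
  w_dvd : ∀ J ∈ D, ∀ J' ∈ D, J ⊂ J' → w J' ∣ w J
  /-- Members of `D` directly below the same member of `D` have the same weight. -/
  w_eq : ∀ J₁ ∈ D, ∀ J₂ ∈ D, ∀ J ∈ D,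
    (J₁ ⊂ J ∧ ∀ K ∈ D, ¬ (J₁ ⊂ K ∧ K ⊂ J)) →
    (J₂ ⊂ J ∧ ∀ K ∈ D, ¬ (J₂ ⊂ K ∧ K ⊂ J)) → w J₁ = w J₂

namespace SpecialDatum

variable {n : ℕ} (𝔻 : SpecialDatum n)

/-- The monomial `x_J ^ w(J)`, where `x_J = ∏_{j ∈ J} x_j`. -/
def monomial (J : Finset (Fin n)) : MvPolynomial (Fin n) ℂ :=
  (∏ j ∈ J, MvPolynomial.X j) ^ 𝔻.w J

/-- The ring `R_𝔻 = ℂ[x_J ^ w(J) | J ∈ D]`, a subalgebra of `ℂ[x_1, …, x_n]`. -/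
def ring : Subalgebra ℂ (MvPolynomial (Fin n) ℂ) :=
  Algebra.adjoin ℂ {p | ∃ J ∈ 𝔻.D, p = 𝔻.monomial J}

/-- The ideal `𝔪_𝔻 = (x_J ^ w(J) | J ∈ D)` of `R_𝔻`. -/
def maxIdeal : Ideal 𝔻.ring :=
  Ideal.span {r | ∃ J ∈ 𝔻.D, (r : MvPolynomial (Fin n) ℂ) = 𝔻.monomial J}

theorem w_pos {J : Finset (Fin n)} (hJ : J ∈ 𝔻.D) : 0 < 𝔻.w J := by
  obtain ⟨K, hJK, hK⟩ := 𝔻.D.exists_le_maximal hJ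
  rcases eq_or_lt_of_le hJK with rfl | h
  · rw [𝔻.w_maximal _ hK]; exact one_pos
  · exact lt_of_le_of_lt (Nat.zero_le _) (𝔻.w_lt J hJ K hK.prop h)

/-- Evaluation at the origin, `R_𝔻 → ℂ`. -/
def evalZero : 𝔻.ring →+* ℂ :=
  (MvPolynomial.constantCoeff (R := ℂ) (σ := Fin n)).comp 𝔻.ring.val.toRingHom

theorem maxIdeal_eq_ker : 𝔻.maxIdeal = RingHom.ker 𝔻.evalZero := by
  apply le_antisymm
  · refine Ideal.span_le.2 ?_
    rintro r ⟨J, hJ, hr⟩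
    obtain ⟨j, hj⟩ := 𝔻.nonempty_of_mem J hJ
    change MvPolynomial.constantCoeff (r : MvPolynomial (Fin n) ℂ) = 0
    rw [hr, monomial, map_pow, map_prod, Finset.prod_eq_zero hj (by simp),
      zero_pow (𝔻.w_pos hJ).ne']
  · have key : ∀ p (hp : p ∈ 𝔻.ring), (⟨p, hp⟩ : 𝔻.ring) -
        algebraMap ℂ 𝔻.ring (MvPolynomial.constantCoeff p) ∈ 𝔻.maxIdeal := by
      intro p hp
      induction hp using Algebra.adjoin_induction with
      | mem x hx =>
        obtain ⟨J, hJ, rfl⟩ := hx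
        obtain ⟨j, hj⟩ := 𝔻.nonempty_of_mem J hJ
        have h0 : MvPolynomial.constantCoeff (𝔻.monomial J) = 0 := by
          rw [monomial, map_pow, map_prod, Finset.prod_eq_zero hj (by simp),
            zero_pow (𝔻.w_pos hJ).ne']
        rw [h0, map_zero, sub_zero]
        exact Ideal.subset_span ⟨J, hJ, rfl⟩
      | algebraMap r =>
        convert 𝔻.maxIdeal.zero_mem
        rw [sub_eq_zero]
        apply Subtype.ext
        simp [MvPolynomial.algebraMap_eq]
      | add x y hx hy ihx ihy =>
        have := 𝔻.maxIdeal.add_mem ihx ihy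
        convert this using 1
        rw [map_add, map_add]
        have e : (⟨x + y, add_mem hx hy⟩ : 𝔻.ring) = ⟨x, hx⟩ + ⟨y, hy⟩ := rfl
        refine Eq.trans (congrArg (· - _) e) ?_
        ring
      | mul x y hx hy ihx ihy =>
        have := 𝔻.maxIdeal.add_mem (𝔻.maxIdeal.mul_mem_right ⟨y, hy⟩ ihx)
          (𝔻.maxIdeal.mul_mem_left
            (algebraMap ℂ 𝔻.ring (MvPolynomial.constantCoeff x)) ihy)
        convert this using 1
        rw [map_mul, map_mul]
        have e : (⟨x * y, mul_mem hx hy⟩ : 𝔻.ring) = ⟨x, hx⟩ * ⟨y, hy⟩ := rfl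
        refine Eq.trans (congrArg (· - _) e) ?_
        ring
    intro r hr
    have h := key r.1 r.2
    have h0 : MvPolynomial.constantCoeff (r : MvPolynomial (Fin n) ℂ) = 0 := hr
    rw [h0, map_zero, sub_zero] at h
    exact h

instance maxIdeal_isPrime : 𝔻.maxIdeal.IsPrime := by
  rw [maxIdeal_eq_ker]
  exact RingHom.ker_isPrime _

/-- The local ring of `R_𝔻` at `𝔪_𝔻`. -/
abbrev LocalRing : Type := Localization.AtPrime 𝔻.maxIdeal

/-- `e(R_𝔻)`, the Hilbert–Samuel multiplicity of the local ring of `R_𝔻` at `𝔪_𝔻`. -/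
def e : ℝ := hilbertSamuelMultiplicity 𝔻.LocalRing

/-- `emb(R_𝔻)`, the embedding dimension of the local ring of `R_𝔻` at `𝔪_𝔻`. -/
def emb : ℕ := embeddingDimension 𝔻.LocalRing

end SpecialDatum

end

/-!
The ring `R_𝔻` is spanned by monomials, so the length of `A / 𝔪 ^ k` is the number of monomials of
`R_𝔻` that are not products of `k` or more generators. Every such monomial has a largest
factorization in a graded monomial order on the exponents, and these largest factorizations form a
lower set, so their number is eventually a polynomial in `k`.

If `J ∈ D` is not a singleton, then the product of the generators at the children of `J`, the
members of `D` directly below `J`, is a power of the generator at `J`. Replacing the former by the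
latter brings every monomial of `R_𝔻` into a unique normal form which omits some child of each such
`J`. The normal forms are the standard monomials of an ideal generated by monomials with pairwise
disjoint supports, of degrees the numbers of children. Hence `e(R_𝔻)` is at most the product of
these numbers, with equality if every such `J` has exactly two children, because then the
replacement does not lower the number of generators.

Since `D` is a forest with the `n` singletons as leaves, the numbers of children, each reduced by
one, add up to `n` minus the number of maximal members. As `c ≤ 2 ^ (c - 1)`, with equality only
for `c ≤ 2`, the product is at most `2 ^ (n - 1)`, with equality if and only if there is one maximal
member and all numbers of children are `2`, that is, if `D` has `2 * n - 1` members. No generator is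
a product of others, so the number of members of `D` is the embedding dimension.
-/

noncomputable section

section EventuallyPoly

/-- The function `f` on `ℕ` agrees with the polynomial `p` at all large arguments; this is how a
Hilbert–Samuel function is related to its Hilbert–Samuel polynomial. -/
def EventuallyEqPoly (f : ℕ → ℕ) (p : Polynomial ℝ) : Prop :=
  ∀ᶠ k : ℕ in atTop, (f k : ℝ) = p.eval (k : ℝ)

theorem EventuallyEqPoly.sub_shift {f g h : ℕ → ℕ} {p q : Polynomial ℝ} {c : ℕ}
    (hf : EventuallyEqPoly f p) (hg : EventuallyEqPoly g q) (h_add : ∀ k, h k + g (k - c) = f k) :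
    EventuallyEqPoly h (p - Polynomial.taylor (-c : ℝ) q) := by
  filter_upwards [hf, (tendsto_sub_atTop_nat c).eventually hg, eventually_ge_atTop c]
    with k hfk hgk hck
  rw [Polynomial.eval_sub, Polynomial.taylor_eval, ← hfk, ← h_add, ← sub_eq_add_neg,
    ← Nat.cast_sub hck, ← hgk]
  push_cast
  ring

theorem taylor_coeff_of_natDegree_le {p : Polynomial ℝ} {d : ℕ} (hp : p.natDegree ≤ d + 1)
    (r : ℝ) : (Polynomial.taylor r p).coeff d = (d + 1) * p.coeff (d + 1) * r + p.coeff d := by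
  have hderiv : (Polynomial.hasseDeriv d p).natDegree ≤ 1 :=
    (Polynomial.natDegree_hasseDeriv_le p d).trans (by omega)
  rw [Polynomial.taylor_coeff, Polynomial.eq_X_add_C_of_natDegree_le_one hderiv,
    Polynomial.hasseDeriv_coeff, Polynomial.hasseDeriv_coeff]
  simp [add_comm 1 d]

theorem natDegree_sub_taylor_le {p : Polynomial ℝ} {d : ℕ} (hp : p.natDegree ≤ d + 1) (r : ℝ) :
    (p - Polynomial.taylor r p).natDegree ≤ d := by
  refine Polynomial.natDegree_le_iff_coeff_eq_zero.2 fun N hN => ?_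
  have hpN : p.natDegree ≤ N + 1 := by omega
  have hzero : p.coeff (N + 1) = 0 := Polynomial.coeff_eq_zero_of_natDegree_lt (by omega)
  simp [taylor_coeff_of_natDegree_le hpN, hzero]

theorem tendsto_eval_div_pow {p : Polynomial ℝ} {d : ℕ} (hp : p.natDegree ≤ d) :
    Tendsto (fun x : ℝ => p.eval x / x ^ d) atTop (𝓝 (p.coeff d)) := by
  have hX : (Polynomial.X ^ d : Polynomial ℝ).degree = d := Polynomial.degree_X_pow d
  rcases (Polynomial.degree_le_of_natDegree_le hp).lt_or_eq with hlt | heq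
  · rw [Polynomial.coeff_eq_zero_of_degree_lt hlt]
    simpa using p.div_tendsto_atTop_zero_of_degree_lt (Polynomial.X ^ d) (hlt.trans_eq hX.symm)
  · have hcoeff : p.leadingCoeff = p.coeff d := by
      rw [Polynomial.leadingCoeff, Polynomial.natDegree_eq_of_degree_eq_some heq]
    simpa [hcoeff] using
      p.div_tendsto_atTop_leadingCoeff_div_of_degree_eq (Polynomial.X ^ d) (heq.trans hX.symm)

theorem EventuallyEqPoly.tendsto_div_pow {f : ℕ → ℕ} {p : Polynomial ℝ} {d : ℕ}
    (hf : EventuallyEqPoly f p) (hp : p.natDegree ≤ d) :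
    Tendsto (fun k : ℕ => (f k : ℝ) / (k : ℝ) ^ d) atTop (𝓝 (p.coeff d)) := by
  refine ((tendsto_eval_div_pow hp).comp tendsto_natCast_atTop_atTop).congr' ?_
  filter_upwards [hf] with k hk
  simp [hk]

theorem EventuallyEqPoly.natDegree_le_of_le {f g : ℕ → ℕ} {p q : Polynomial ℝ}
    (hf : EventuallyEqPoly f p) (hg : EventuallyEqPoly g q) (hfg : ∀ k, f k ≤ g k) :
    p.natDegree ≤ q.natDegree := by
  by_contra! hlt
  have hzero : Tendsto (fun k : ℕ => (g k : ℝ) / (k : ℝ) ^ p.natDegree) atTop (𝓝 0) := by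
    simpa only [Polynomial.coeff_eq_zero_of_natDegree_lt hlt] using hg.tendsto_div_pow hlt.le
  have hlead : p.leadingCoeff = 0 :=
    tendsto_nhds_unique (hf.tendsto_div_pow le_rfl)
      (squeeze_zero (fun k => by positivity) (fun k => by gcongr; exact hfg k) hzero)
  rw [Polynomial.leadingCoeff_eq_zero.1 hlead, Polynomial.natDegree_zero] at hlt
  exact Nat.not_lt_zero _ hlt

end EventuallyPoly

section DegreeCount

variable {ι : Type*}

/-- The number of exponent vectors in `B` of degree less than `k`. -/
def degreeCount (B : Set (ι →₀ ℕ)) (k : ℕ) : ℕ :=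
  {m | m ∈ B ∧ m.degree < k}.ncard

theorem finite_setOf_degree_lt [Finite ι] (k : ℕ) : {m : ι →₀ ℕ | m.degree < k}.Finite :=
  (Finsupp.finite_of_degree_le k).subset fun m (h : m.degree < k) => h.le

theorem finite_setOf_mem_degree_lt [Finite ι] (B : Set (ι →₀ ℕ)) (k : ℕ) :
    {m | m ∈ B ∧ m.degree < k}.Finite :=
  (finite_setOf_degree_lt k).subset fun _ h => h.2

theorem degreeCount_univ [Fintype ι] (k : ℕ) :
    degreeCount (Set.univ : Set (ι →₀ ℕ)) (k + 1) =
      (k + Fintype.card ι).choose (Fintype.card ι) := by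
  classical
  have h_union : {m : ι →₀ ℕ | m ∈ Set.univ ∧ m.degree < k + 1} =
      ((Finset.range (k + 1)).biUnion fun j => Finset.univ.finsuppAntidiag j :
        Finset (ι →₀ ℕ)) := by
    ext m
    simp [Finset.mem_finsuppAntidiag, Finsupp.degree_eq_sum]
  rw [degreeCount, h_union, Set.ncard_coe_finset, Finset.card_biUnion, ← Nat.sum_range_multichoose]
  · simp only [Finset.card_finsuppAntidiag_nat_eq_multichoose, Finset.card_univ]
  · intro i _ j _ hij
    refine Finset.disjoint_left.2 fun m hi hj => hij ?_
    rw [← (Finset.mem_finsuppAntidiag.1 hi).1, (Finset.mem_finsuppAntidiag.1 hj).1]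

theorem eventuallyEqPoly_degreeCount_univ [Fintype ι] :
    EventuallyEqPoly (degreeCount (Set.univ : Set (ι →₀ ℕ)))
      (Polynomial.preHilbertPoly ℝ (Fintype.card ι) 1) := by
  filter_upwards [eventually_ge_atTop 1] with k hk
  rw [Polynomial.preHilbertPoly_eq_choose_sub_add ℝ _ hk, ← degreeCount_univ, Nat.sub_add_cancel hk]

theorem degreeCount_not_le_add [Finite ι] (B : Set (ι →₀ ℕ)) (g : ι →₀ ℕ) (k : ℕ) :
    degreeCount {m ∈ B | ¬ g ≤ m} k + degreeCount {m | g + m ∈ B} (k - g.degree) =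
      degreeCount B k := by
  have h_image : {m | g + m ∈ B ∧ m.degree < k - g.degree}.ncard =
      {m | m ∈ B ∧ m.degree < k ∧ g ≤ m}.ncard := by
    rw [← Set.ncard_image_of_injective _ (add_right_injective g)]
    congr 1
    ext m
    constructor
    · rintro ⟨m, ⟨hB, hdeg⟩, rfl⟩
      exact ⟨hB, by simp only [map_add]; omega, le_self_add⟩
    · rintro ⟨hB, hdeg, hgm⟩
      obtain ⟨m, rfl⟩ := exists_add_of_le hgm
      rw [map_add] at hdeg
      exact ⟨m, ⟨hB, by omega⟩, rfl⟩
  have h_split : {m | m ∈ B ∧ m.degree < k} =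
      {m | m ∈ {m ∈ B | ¬ g ≤ m} ∧ m.degree < k} ∪ {m | m ∈ B ∧ m.degree < k ∧ g ≤ m} := by
    ext m
    simp only [Set.mem_ofPred_eq, Set.mem_union]
    tauto
  simp only [degreeCount]
  rw [h_split, Set.ncard_union_eq ?_ (finite_setOf_mem_degree_lt _ k)
    ((finite_setOf_degree_lt k).subset fun _ h => h.2.1)]
  · exact congrArg _ h_image
  · exact Set.disjoint_left.2 fun m h h' => h.1.2 h'.2.2

end DegreeCount

section Standard

variable {ι τ : Type*}

/-- The exponents of the standard monomials of the monomial ideal generated by the monomials with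
exponents `g t`, `t ∈ T`, that is, of the monomials outside this ideal. -/
def standard (T : Finset τ) (g : τ → ι →₀ ℕ) : Set (ι →₀ ℕ) :=
  {m | ∀ t ∈ T, ¬ g t ≤ m}

theorem standard_empty (g : τ → ι →₀ ℕ) : standard ∅ g = Set.univ := by
  simp [standard]

theorem standard_insert [DecidableEq τ] (t : τ) (T : Finset τ) (g : τ → ι →₀ ℕ) :
    standard (insert t T) g = {m ∈ standard T g | ¬ g t ≤ m} := by
  ext m
  simp [standard, and_comm]

theorem setOf_add_mem_standard (a : ι →₀ ℕ) (T : Finset τ) (g : τ → ι →₀ ℕ) :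
    {m | a + m ∈ standard T g} = standard T fun t => g t - a := by
  ext m
  simp only [standard, Set.mem_ofPred_eq, tsub_le_iff_left]

theorem exists_eventuallyEqPoly_degreeCount_standard [Finite ι] (T : Finset τ)
    (g : τ → ι →₀ ℕ) : ∃ p, EventuallyEqPoly (degreeCount (standard T g)) p := by
  classical
  have := Fintype.ofFinite ι
  induction T using Finset.induction_on generalizing g with
  | empty => exact standard_empty g ▸ ⟨_, eventuallyEqPoly_degreeCount_univ⟩
  | insert t T _ ih =>
    obtain ⟨p, hp⟩ := ih g
    obtain ⟨q, hq⟩ := ih fun s => g s - g t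
    rw [← setOf_add_mem_standard] at hq
    rw [standard_insert]
    exact ⟨_, hp.sub_shift hq fun k => degreeCount_not_le_add (standard T g) (g t) k⟩

/-- The complement of a lower set is generated by its minimal elements, which form an antichain and
hence are finitely many by Dickson's lemma. -/
theorem exists_eq_standard_of_isLowerSet [Finite ι] {B : Set (ι →₀ ℕ)} (hB : IsLowerSet B) :
    ∃ T : Finset (ι →₀ ℕ), B = standard T id := by
  have h_finite : {g | Minimal (· ∈ Bᶜ) g}.Finite :=
    (setOfPred_minimal_antichain _).finite_of_partiallyWellOrderedOn
      (Set.isPWO_of_wellQuasiOrderedLE _)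
  refine ⟨h_finite.toFinset, Set.ext fun m => ⟨fun hm g hg hgm => ?_, fun hm => ?_⟩⟩
  · exact (h_finite.mem_toFinset.1 hg).prop (hB hgm hm)
  · by_contra hmB
    obtain ⟨g, hgm, hg⟩ := exists_minimal_le_of_wellFoundedLT (· ∈ Bᶜ) m hmB
    exact hm g (h_finite.mem_toFinset.2 hg) hgm

theorem exists_eventuallyEqPoly_degreeCount_of_isLowerSet [Finite ι] {B : Set (ι →₀ ℕ)}
    (hB : IsLowerSet B) : ∃ p, EventuallyEqPoly (degreeCount B) p := by
  obtain ⟨T, rfl⟩ := exists_eq_standard_of_isLowerSet hB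
  exact exists_eventuallyEqPoly_degreeCount_standard T id

theorem tsub_eq_left_of_disjoint {a b : ι →₀ ℕ} (hab : Disjoint a b) : a - b = a := by
  ext i
  have h_inf : min (a i) (b i) = 0 := DFunLike.congr_fun (disjoint_iff.1 hab) i
  rw [Finsupp.tsub_apply]
  omega

theorem exists_eventuallyEqPoly_degreeCount_standard_of_disjoint [Fintype ι] {g : τ → ι →₀ ℕ}
    {T : Finset τ} (hg : (T : Set τ).Pairwise fun s t => Disjoint (g s) (g t)) {d : ℕ}
    (hd : d + T.card = Fintype.card ι) :
    ∃ p, EventuallyEqPoly (degreeCount (standard T g)) p ∧ p.natDegree ≤ d ∧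
      d.factorial * p.coeff d = ∏ t ∈ T, ((g t).degree : ℝ) := by
  classical
  induction T using Finset.induction_on generalizing d with
  | empty =>
    obtain rfl : d = Fintype.card ι := by simpa using hd
    refine ⟨_, standard_empty g ▸ eventuallyEqPoly_degreeCount_univ,
      (Polynomial.natDegree_preHilbertPoly ℝ _ _).le, ?_⟩
    rw [Polynomial.coeff_preHilbertPoly_self, Finset.prod_empty]
    exact mul_inv_cancel₀ (by positivity)
  | insert t T ht ih =>
    rw [Finset.card_insert_of_notMem ht] at hd
    obtain ⟨p, hp, hdeg, hcoeff⟩ := ih (hg.mono (by simp)) (d := d + 1) (by omega)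
    have h_colon : standard T g = {m | g t + m ∈ standard T g} := by
      rw [setOf_add_mem_standard]
      ext m
      refine forall₂_congr fun s hs => ?_
      have hst : Disjoint (g s) (g t) := hg (by simp [hs]) (by simp) (ne_of_mem_of_not_mem hs ht)
      simp only [tsub_eq_left_of_disjoint hst]
    refine ⟨_, standard_insert t T g ▸ hp.sub_shift (h_colon ▸ hp) fun k =>
      degreeCount_not_le_add (standard T g) (g t) k, natDegree_sub_taylor_le hdeg _, ?_⟩
    rw [Finset.prod_insert ht, ← hcoeff, Polynomial.coeff_sub, taylor_coeff_of_natDegree_le hdeg,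
      Nat.factorial_succ]
    push_cast
    ring

end Standard

section MonomialOrder

variable {ι σ : Type*}

/-- The exponents of the products of at least `k` factors from the family of monomials with
exponents `a i`. -/
def orderGE (a : ι → σ →₀ ℕ) (k : ℕ) : Set (σ →₀ ℕ) :=
  Finsupp.linearCombination ℕ a '' {m | k ≤ m.degree}

/-- The exponents of the products of factors from the family of monomials with exponents `a i` that
cannot be written with `k` or more factors. -/
def orderLT (a : ι → σ →₀ ℕ) (k : ℕ) : Set (σ →₀ ℕ) :=
  orderGE a 0 \ orderGE a k

variable {a : ι → σ →₀ ℕ}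

theorem mem_orderLT {k : ℕ} {s : σ →₀ ℕ} :
    s ∈ orderLT a k ↔ (∃ m, Finsupp.linearCombination ℕ a m = s) ∧
      ∀ m, Finsupp.linearCombination ℕ a m = s → m.degree < k := by
  simp only [orderLT, orderGE, zero_le, Set.ofPred_true, Set.image_univ, Set.mem_sdiff,
    Set.mem_range, Set.mem_image, Set.mem_ofPred_eq, not_exists, not_and', not_le]

open scoped Pointwise in
theorem orderGE_succ (a : ι → σ →₀ ℕ) (k : ℕ) :
    orderGE a (k + 1) = orderGE a k + Set.range a := by
  refine Set.Subset.antisymm ?_ (Set.add_subset_iff.2 ?_)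
  · rintro _ ⟨m, hm : k + 1 ≤ m.degree, rfl⟩
    obtain ⟨i, hi⟩ : m.support.Nonempty := by
      rw [Finsupp.support_nonempty_iff]
      rintro rfl
      simp at hm
    obtain ⟨m, rfl⟩ := exists_add_of_le (Finsupp.single_le_iff.2
      (Nat.one_le_iff_ne_zero.2 (Finsupp.mem_support_iff.1 hi)))
    have hm' : k ≤ m.degree := by
      rw [map_add, Finsupp.degree_single] at hm
      omega
    rw [map_add, Finsupp.linearCombination_single, one_smul, add_comm (a i)]
    exact Set.add_mem_add (Set.mem_image_of_mem _ hm') (Set.mem_range_self i)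
  · rintro _ ⟨m, hm : k ≤ m.degree, rfl⟩ _ ⟨i, rfl⟩
    exact ⟨m + Finsupp.single i 1, by simpa using hm, by simp⟩

open scoped Pointwise in
theorem orderGE_add_orderGE_zero (a : ι → σ →₀ ℕ) (k : ℕ) :
    orderGE a k + orderGE a 0 = orderGE a k := by
  refine Set.Subset.antisymm (Set.add_subset_iff.2 ?_) fun s hs =>
    Set.mem_add.2 ⟨s, hs, 0, ⟨0, by simp⟩, add_zero s⟩
  rintro _ ⟨m, hm : k ≤ m.degree, rfl⟩ _ ⟨m', -, rfl⟩
  exact ⟨m + m', (le_add_right hm).trans_eq (map_add _ _ _).symm, map_add _ _ _⟩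

theorem finite_orderLT [Finite ι] (a : ι → σ →₀ ℕ) (k : ℕ) : (orderLT a k).Finite := by
  refine ((finite_setOf_degree_lt k).image (Finsupp.linearCombination ℕ a)).subset fun s hs => ?_
  obtain ⟨⟨m, rfl⟩, h_lt⟩ := mem_orderLT.1 hs
  exact ⟨m, h_lt m rfl, rfl⟩

theorem degree_le_degree_linearCombination (ha : ∀ i, a i ≠ 0) (m : ι →₀ ℕ) :
    m.degree ≤ (Finsupp.linearCombination ℕ a m).degree := by
  rw [Finsupp.linearCombination_apply, Finsupp.sum, map_sum, Finsupp.degree_apply]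
  refine Finset.sum_le_sum fun i _ => ?_
  rw [map_nsmul, smul_eq_mul]
  have h_pos : (a i).degree ≠ 0 := fun h => ha i ((Finsupp.degree_eq_zero_iff _).1 h)
  exact Nat.le_mul_of_pos_right _ (Nat.pos_of_ne_zero h_pos)

theorem finite_setOf_linearCombination_eq [Finite ι] (ha : ∀ i, a i ≠ 0) (s : σ →₀ ℕ) :
    {m | Finsupp.linearCombination ℕ a m = s}.Finite := by
  refine (Finsupp.finite_of_degree_le s.degree).subset ?_
  rintro m rfl
  exact degree_le_degree_linearCombination ha m

/-- Among the ways to write a monomial as a product of factors, choose the largest one in a graded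
monomial order. The chosen exponents form a lower set, and have as many factors as possible. -/
theorem exists_eventuallyEqPoly_ncard_orderLT [Finite ι] (ha : ∀ i, a i ≠ 0) :
    ∃ p, EventuallyEqPoly (fun k => (orderLT a k).ncard) p := by
  classical
  let _ : LinearOrder ι := linearOrderOfSTO WellOrderingRel
  let E := Finsupp.linearCombination ℕ a
  let key : (ι →₀ ℕ) → DegLex (ι →₀ ℕ) := toDegLex
  let B : Set (ι →₀ ℕ) := {m | ∀ m', E m' = E m → key m' ≤ key m}
  have h_lower : IsLowerSet B := by
    intro m m₀ h_le hm m' h_eq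
    obtain ⟨c, rfl⟩ := exists_add_of_le h_le
    exact le_of_add_le_add_right (hm (m' + c) (by rw [map_add, map_add, h_eq]))
  have h_injOn : Set.InjOn E B := fun m hm m' hm' h_eq =>
    toDegLex.injective ((hm' m h_eq).antisymm (hm m' h_eq.symm))
  have h_image (k : ℕ) : orderLT a k = E '' {m | m ∈ B ∧ m.degree < k} := by
    ext s
    rw [mem_orderLT]
    constructor
    · rintro ⟨⟨m, hm⟩, h_lt⟩
      obtain ⟨b, rfl, hb⟩ := Set.exists_max_image {m | E m = s} key
        (finite_setOf_linearCombination_eq ha s) ⟨m, hm⟩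
      exact ⟨b, ⟨hb, h_lt b rfl⟩, rfl⟩
    · rintro ⟨b, ⟨hb, hbk⟩, rfl⟩
      exact ⟨⟨b, rfl⟩, fun m hm => (Finsupp.DegLex.monotone_degree (hb m hm)).trans_lt hbk⟩
  obtain ⟨p, hp⟩ := exists_eventuallyEqPoly_degreeCount_of_isLowerSet h_lower
  refine ⟨p, hp.mono fun k hk => ?_⟩
  have h_injOn' : Set.InjOn E {m | m ∈ B ∧ m.degree < k} := h_injOn.mono fun _ hm => hm.1
  simpa only [h_image, h_injOn'.ncard_image, degreeCount] using hk

end MonomialOrder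

section Irreducible

variable {ι σ : Type*} {a : ι → σ →₀ ℕ}

theorem orderLT_two_eq_insert_range
    (ha : ∀ m i, Finsupp.linearCombination ℕ a m = a i → m = Finsupp.single i 1) :
    orderLT a 2 = insert 0 (Set.range a) := by
  have h_zero (m) (hm : Finsupp.linearCombination ℕ a m = 0) : m = 0 := by
    by_contra h_ne
    obtain ⟨i, -⟩ := Finsupp.support_nonempty_iff.2 h_ne
    exact h_ne (add_eq_right.1 (ha (m + Finsupp.single i 1) i (by simp [hm])))
  ext s
  rw [mem_orderLT, Set.mem_insert_iff, Set.mem_range]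
  constructor
  · rintro ⟨⟨m, rfl⟩, h_lt⟩
    rcases Nat.le_one_iff_eq_zero_or_eq_one.1 (Nat.le_of_lt_succ (h_lt m rfl)) with h | h
    · exact .inl (by rw [(Finsupp.degree_eq_zero_iff m).1 h, map_zero])
    · obtain ⟨i, rfl⟩ := (Finsupp.sum_eq_one_iff m).1 h
      exact .inr ⟨i, by simp⟩
  · rintro (rfl | ⟨i, rfl⟩)
    · exact ⟨⟨0, map_zero _⟩, fun m hm => by simp [h_zero m hm]⟩
    · exact ⟨⟨Finsupp.single i 1, by simp⟩, fun m hm => by simp [ha m i hm]⟩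

theorem ncard_orderLT_two [Fintype ι]
    (ha : ∀ m i, Finsupp.linearCombination ℕ a m = a i → m = Finsupp.single i 1) :
    (orderLT a 2).ncard = Fintype.card ι + 1 := by
  have h_inj : Function.Injective a := fun i j hij =>
    (Finsupp.single_left_inj one_ne_zero).1 (ha (Finsupp.single i 1) j (by simp [hij]))
  have h_zero : (0 : σ →₀ ℕ) ∉ Set.range a := by
    rintro ⟨i, hi⟩
    exact Finsupp.single_ne_zero.2 one_ne_zero (ha 0 i (by rw [map_zero, hi])).symm
  rw [orderLT_two_eq_insert_range ha, Set.ncard_insert_of_notMem h_zero (Set.finite_range a),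
    ← Set.image_univ, Set.ncard_image_of_injective _ h_inj, Set.ncard_univ,
    Nat.card_eq_fintype_card]

end Irreducible

section MonomialAlgebra

variable {ι σ K : Type*} [Field K] {a : ι → σ →₀ ℕ}

open MvPolynomial

theorem monomial_linearCombination (a : ι → σ →₀ ℕ) (m : ι →₀ ℕ) :
    monomial (Finsupp.linearCombination ℕ a m) (1 : K) =
      m.prod fun i c => monomial (a i) 1 ^ c := by
  rw [Finsupp.linearCombination_apply, Finsupp.sum, monomial_sum_one, Finsupp.prod]
  exact Finset.prod_congr rfl fun i _ => by rw [monomial_pow, one_pow]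

theorem mul_mem_restrictSupport_orderGE {p q : MvPolynomial σ K} {k : ℕ}
    (hp : p ∈ restrictSupport K (orderGE a k)) (hq : q ∈ restrictSupport K (orderGE a 0)) :
    p * q ∈ restrictSupport K (orderGE a k) := by
  rw [← orderGE_add_orderGE_zero, restrictSupport_add]
  exact Submodule.mul_mem_mul hp hq

theorem toSubmodule_adjoin_range_monomial (a : ι → σ →₀ ℕ) :
    Subalgebra.toSubmodule (Algebra.adjoin K (Set.range fun i => monomial (a i) (1 : K))) =
      restrictSupport K (orderGE a 0) := by
  refine le_antisymm (fun p hp => ?_) ?_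
  · induction hp using Algebra.adjoin_induction with
    | mem p hp =>
      obtain ⟨i, rfl⟩ := hp
      exact (monomial_mem_restrictSupport K).2 (.inl ⟨Finsupp.single i 1, by simp⟩)
    | algebraMap c => exact (monomial_mem_restrictSupport K).2 (.inl ⟨0, by simp⟩)
    | add p q _ _ hp hq => exact add_mem hp hq
    | mul p q _ _ hp hq => exact mul_mem_restrictSupport_orderGE hp hq
  · rw [restrictSupport_eq_span, Submodule.span_le]
    rintro _ ⟨_, ⟨m, -, rfl⟩, rfl⟩
    simp only [monomial_linearCombination]
    exact Subalgebra.prod_mem _ fun i _ =>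
      pow_mem (Algebra.subset_adjoin (Set.mem_range_self i)) _

variable {R : Subalgebra K (MvPolynomial σ K)} {I : Ideal R}

theorem map_val_span_monomial
    (hR : R = Algebra.adjoin K (Set.range fun i => monomial (a i) (1 : K)))
    (hI : I = Ideal.span {r : R | ∃ i, (r : MvPolynomial σ K) = monomial (a i) 1}) :
    (I.restrictScalars K).map R.val.toLinearMap = restrictSupport K (orderGE a 1) := by
  have h_mem (p : MvPolynomial σ K) : p ∈ R ↔ p ∈ restrictSupport K (orderGE a 0) := by
    rw [← toSubmodule_adjoin_range_monomial, ← hR, Subalgebra.mem_toSubmodule]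
  have h_gen (i : ι) : monomial (a i) 1 ∈ R :=
    hR ▸ Algebra.subset_adjoin (Set.mem_range_self i)
  refine le_antisymm (Submodule.map_le_iff_le_comap.2 fun r hr => ?_) ?_
  · change r ∈ I at hr
    change r.1 ∈ restrictSupport K (orderGE a 1)
    rw [hI] at hr
    induction hr using Submodule.span_induction with
    | mem r hr =>
      obtain ⟨i, hi⟩ := hr
      exact hi ▸ (monomial_mem_restrictSupport K).2 (.inl ⟨Finsupp.single i 1, by simp⟩)
    | zero => exact zero_mem _
    | add r s _ _ hr hs => exact add_mem hr hs
    | smul r s _ hs =>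
      rw [smul_eq_mul, mul_comm]
      exact mul_mem_restrictSupport_orderGE hs ((h_mem r).1 r.2)
  · rw [← zero_add 1, orderGE_succ, restrictSupport_eq_span, Submodule.span_le]
    rintro _ ⟨_, ⟨s, hs, _, ⟨i, rfl⟩, rfl⟩, rfl⟩
    have hsR : monomial s 1 ∈ R := (h_mem _).2 ((monomial_mem_restrictSupport K).2 (.inl hs))
    have h_genI : ⟨monomial (a i) 1, h_gen i⟩ ∈ I := hI ▸ Ideal.subset_span ⟨i, rfl⟩
    exact ⟨⟨_, hsR⟩ * ⟨_, h_gen i⟩, I.mul_mem_left _ h_genI, by simp⟩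

open scoped Pointwise in
theorem map_val_span_monomial_pow
    (hR : R = Algebra.adjoin K (Set.range fun i => monomial (a i) (1 : K)))
    (hI : I = Ideal.span {r : R | ∃ i, (r : MvPolynomial σ K) = monomial (a i) 1}) (k : ℕ) :
    ((I ^ k).restrictScalars K).map R.val.toLinearMap = restrictSupport K (orderGE a k) := by
  induction k with
  | zero =>
    rw [← toSubmodule_adjoin_range_monomial, ← hR]
    ext
    simp
  | succ k ih =>
    have h_one : orderGE a 1 = orderGE a 0 + Set.range a := orderGE_succ a 0
    rw [pow_succ, Ideal.restrictScalars_mul, Submodule.map_mul, ih, map_val_span_monomial hR hI,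
      ← restrictSupport_add, h_one, ← add_assoc, orderGE_add_orderGE_zero, ← orderGE_succ]

/-- The classes of the monomials with exponents in `orderLT a k` form a basis of `R / I ^ k`. -/
theorem nonempty_quotient_pow_equiv
    (hR : R = Algebra.adjoin K (Set.range fun i => monomial (a i) (1 : K)))
    (hI : I = Ideal.span {r : R | ∃ i, (r : MvPolynomial σ K) = monomial (a i) 1}) (k : ℕ) :
    Nonempty ((R ⧸ I ^ k) ≃ₗ[K] (orderLT a k →₀ K)) := by
  have h_mem (p : MvPolynomial σ K) : p ∈ R ↔ p ∈ restrictSupport K (orderGE a 0) := by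
    rw [← toSubmodule_adjoin_range_monomial, ← hR, Subalgebra.mem_toSubmodule]
  have h_mem_pow (r : R) : r ∈ I ^ k ↔ r.1 ∈ restrictSupport K (orderGE a k) := by
    rw [← map_val_span_monomial_pow hR hI]
    exact (Subtype.val_injective.mem_set_image (s := ((I ^ k : Ideal R) : Set R))).symm
  let φ : R →ₗ[K] (orderLT a k →₀ K) := Finsupp.lsubtypeDomain (orderLT a k) ∘ₗ
    (AddMonoidAlgebra.coeffLinearEquiv K).toLinearMap ∘ₗ R.val.toLinearMap
  have h_ker : LinearMap.ker φ = (I ^ k).restrictScalars K := by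
    ext r
    rw [LinearMap.mem_ker, Submodule.restrictScalars_mem, h_mem_pow, Finsupp.ext_iff]
    constructor
    · intro h s hs
      by_contra hk
      exact mem_support_iff.1 hs (h ⟨s, (h_mem _).1 r.2 hs, hk⟩)
    · intro h s
      exact notMem_support_iff.1 fun hs => s.2.2 (h hs)
  have h_surjective : Function.Surjective φ := by
    classical
    intro f
    let p : MvPolynomial σ K := (AddMonoidAlgebra.coeffLinearEquiv K).symm f.extendDomain
    have hp : p ∈ R := (h_mem p).2 fun s hs => (Finsupp.support_extendDomain_subset f hs).1
    exact ⟨⟨p, hp⟩, Finsupp.subtypeDomain_extendDomain f⟩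
  exact ⟨(Submodule.Quotient.restrictScalarsEquiv K (I ^ k)).symm ≪≫ₗ
    Submodule.quotEquivOfEq _ _ h_ker.symm ≪≫ₗ φ.quotKerEquivOfSurjective h_surjective⟩

end MonomialAlgebra

section TwoPow

variable {α : Type*} {s : Finset α} {f : α → ℕ}

theorem prod_le_two_pow_sum_sub_one (s : Finset α) (f : α → ℕ) :
    ∏ i ∈ s, f i ≤ 2 ^ ∑ i ∈ s, (f i - 1) := by
  rw [← Finset.prod_pow_eq_pow_sum]
  refine Finset.prod_le_prod' fun i _ => ?_
  have h_lt : f i - 1 < 2 ^ (f i - 1) := Nat.lt_two_pow_self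
  omega

theorem prod_lt_two_pow_sum_sub_one (hf : ∀ i ∈ s, 2 ≤ f i) (h_ne : ∃ i ∈ s, f i ≠ 2) :
    ∏ i ∈ s, f i < 2 ^ ∑ i ∈ s, (f i - 1) := by
  obtain ⟨i, hi, hi2⟩ := h_ne
  rw [← Finset.prod_pow_eq_pow_sum]
  refine Finset.prod_lt_prod (fun j hj => by have := hf j hj; omega) (fun j _ => ?_) ⟨i, hi, ?_⟩
  · have h_lt : f j - 1 < 2 ^ (f j - 1) := Nat.lt_two_pow_self
    omega
  · obtain ⟨c, hc⟩ : ∃ c, f i = c + 3 := Nat.exists_eq_add_of_le' (by have := hf i hi; omega)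
    have h_lt : c < 2 ^ c := Nat.lt_two_pow_self
    rw [hc, Nat.add_sub_assoc (by norm_num), pow_add]
    omega

end TwoPow

namespace SpecialDatum

variable {n : ℕ} {𝔻 : SpecialDatum n}

section Tree

variable (𝔻) in
/-- The members of a special datum, ordered by inclusion. By laminarity they form a forest. -/
abbrev Node : Type := {J : Finset (Fin n) // J ∈ 𝔻.D}

namespace Node

variable {J K L : 𝔻.Node} {i : Fin n}

theorem comparable_of_mem (hK : i ∈ K.1) (hJ : i ∈ J.1) : K ≤ J ∨ J ≤ K := by
  rcases 𝔻.laminar K.1 K.2 J.1 J.2 with h_le | h_ge | h_disj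
  · exact .inl h_le
  · exact .inr h_ge
  · exact absurd hJ (Finset.disjoint_left.1 h_disj hK)

theorem le_of_covBy_of_lt (hJ : K ⋖ J) (hL : K < L) : J ≤ L := by
  obtain ⟨i, hi⟩ := 𝔻.nonempty_of_mem K.1 K.2
  rcases comparable_of_mem (hJ.le hi : i ∈ J.1) (hL.le hi : i ∈ L.1) with h_le | h_ge
  · exact h_le
  · exact (h_ge.eq_of_not_lt (hJ.2 hL)).ge

theorem eq_of_covBy (hJ : K ⋖ J) (hL : K ⋖ L) : J = L :=
  (le_of_covBy_of_lt hJ hL.lt).antisymm (le_of_covBy_of_lt hL hJ.lt)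

theorem eq_of_covBy_of_mem (hK : K ⋖ J) (hL : L ⋖ J) (hiK : i ∈ K.1) (hiL : i ∈ L.1) : K = L := by
  rcases comparable_of_mem hiK hiL with h_le | h_ge
  · exact h_le.eq_of_not_lt fun h_lt => hK.2 h_lt hL.lt
  · exact (h_ge.eq_of_not_lt fun h_lt => hL.2 h_lt hK.lt).symm

theorem w_eq_of_covBy (hK : K ⋖ J) (hL : L ⋖ J) : 𝔻.w K.1 = 𝔻.w L.1 :=
  𝔻.w_eq K.1 K.2 L.1 L.2 J.1 J.2
    ⟨hK.lt, fun M hM h => hK.2 (c := ⟨M, hM⟩) h.1 h.2⟩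
    ⟨hL.lt, fun M hM h => hL.2 (c := ⟨M, hM⟩) h.1 h.2⟩

open Classical in
/-- The maximal members of the datum properly contained in `J`. -/
def children (J : 𝔻.Node) : Finset 𝔻.Node :=
  {K | K ⋖ J}

theorem mem_children : K ∈ J.children ↔ K ⋖ J := by
  simp [children]

end Node

variable (𝔻)

open Classical in
/-- The members of the datum that have children. -/
def inner : Finset 𝔻.Node :=
  {J | J.children.Nonempty}

open Classical in
/-- The maximal members of the datum. -/
def roots : Finset 𝔻.Node :=
  {J | IsMax J}

/-- The Hasse diagram of the datum is a binary forest. -/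
def IsBinary : Prop :=
  ∀ J ∈ 𝔻.inner, J.children.card = 2

variable {𝔻}

theorem mem_inner {J : 𝔻.Node} : J ∈ 𝔻.inner ↔ J.children.Nonempty := by
  simp [inner]

theorem notMem_inner_iff {J : 𝔻.Node} : J ∉ 𝔻.inner ↔ ∃ i, J.1 = {i} := by
  rw [mem_inner, Finset.not_nonempty_iff_eq_empty]
  constructor
  · intro h_empty
    obtain ⟨i, hi⟩ := 𝔻.nonempty_of_mem J.1 J.2
    refine ⟨i, by_contra fun h_ne => ?_⟩
    have h_lt : (⟨{i}, 𝔻.singleton_mem i⟩ : 𝔻.Node) < J :=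
      (Finset.singleton_subset_iff.2 hi).ssubset_of_ne (Ne.symm h_ne)
    obtain ⟨K, -, hKJ⟩ := exists_le_covBy_of_lt h_lt
    exact Finset.notMem_empty K (h_empty ▸ Node.mem_children.2 hKJ)
  · rintro ⟨i, hi⟩
    refine Finset.eq_empty_of_forall_notMem fun K hK => ?_
    have h_ssubset : K.1 ⊂ {i} := hi ▸ (Node.mem_children.1 hK).lt
    rw [Finset.ssubset_singleton_iff] at h_ssubset
    exact (𝔻.nonempty_of_mem K.1 K.2).ne_empty h_ssubset

theorem Node.exists_mem_children {J : 𝔻.Node} (hJ : J ∈ 𝔻.inner) {i : Fin n} (hi : i ∈ J.1) :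
    ∃ K ∈ J.children, i ∈ K.1 := by
  have h_lt : (⟨{i}, 𝔻.singleton_mem i⟩ : 𝔻.Node) < J :=
    (Finset.singleton_subset_iff.2 hi).ssubset_of_ne fun h =>
      notMem_inner_iff.2 ⟨i, h.symm⟩ hJ
  obtain ⟨K, hK, hKJ⟩ := exists_le_covBy_of_lt h_lt
  exact ⟨K, mem_children.2 hKJ, Finset.singleton_subset_iff.1 hK⟩

theorem Node.two_le_card_children {J : 𝔻.Node} (hJ : J ∈ 𝔻.inner) : 2 ≤ J.children.card := by
  obtain ⟨K, hK⟩ := mem_inner.1 hJ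
  obtain ⟨i, hiJ, hiK⟩ := Finset.exists_of_ssubset (mem_children.1 hK).lt
  obtain ⟨L, hL, hiL⟩ := exists_mem_children hJ hiJ
  exact Finset.one_lt_card.2 ⟨K, hK, L, hL, fun h => hiK (h ▸ hiL)⟩

theorem pairwise_disjoint_children :
    (𝔻.inner : Set 𝔻.Node).Pairwise fun J L => Disjoint J.children L.children :=
  fun _ _ _ _ h_ne => Finset.disjoint_left.2 fun _ hJ hL =>
    h_ne (Node.eq_of_covBy (Node.mem_children.1 hJ) (Node.mem_children.1 hL))

variable (𝔻)

theorem card_add_card_inner : n + 𝔻.inner.card = Fintype.card 𝔻.Node := by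
  classical
  have h_compl : 𝔻.innerᶜ =
      Finset.univ.image fun i : Fin n => (⟨{i}, 𝔻.singleton_mem i⟩ : 𝔻.Node) := by
    ext J
    simp [notMem_inner_iff, Subtype.ext_iff, eq_comm]
  have h_inj : Function.Injective fun i : Fin n => (⟨{i}, 𝔻.singleton_mem i⟩ : 𝔻.Node) :=
    fun i j h => Finset.singleton_injective (congrArg Subtype.val h)
  rw [← Finset.card_compl_add_card 𝔻.inner, h_compl, Finset.card_image_of_injective _ h_inj,
    Finset.card_univ, Fintype.card_fin]

theorem roots_nonempty (hn : n ≠ 0) : 𝔻.roots.Nonempty := by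
  obtain ⟨J, hJ⟩ := (Set.finite_univ (α := 𝔻.Node)).exists_maximal
    ⟨⟨{⟨0, Nat.pos_of_ne_zero hn⟩}, 𝔻.singleton_mem _⟩, Set.mem_univ _⟩
  exact ⟨J, by simpa [roots, maximal_true] using hJ⟩

theorem sum_card_children_add_card_roots :
    ∑ J ∈ 𝔻.inner, J.children.card + 𝔻.roots.card = Fintype.card 𝔻.Node := by
  classical
  rw [← Finset.card_biUnion fun J hJ L hL => pairwise_disjoint_children hJ hL,
    ← Finset.card_add_card_compl 𝔻.roots, add_comm]
  congr 2
  ext K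
  simp only [Finset.mem_biUnion, Finset.mem_compl, roots, Finset.mem_filter_univ,
    Node.mem_children]
  constructor
  · rintro ⟨J, -, hJ⟩
    exact hJ.lt.not_isMax
  · intro hK
    obtain ⟨J, hJ⟩ := exists_covBy_of_wellFoundedLT hK
    exact ⟨J, mem_inner.2 ⟨K, Node.mem_children.2 hJ⟩, hJ⟩

theorem sum_card_children_sub_one_add_card_roots :
    ∑ J ∈ 𝔻.inner, (J.children.card - 1) + 𝔻.roots.card = n := by
  have h_sum : ∑ J ∈ 𝔻.inner, J.children.card =
      ∑ J ∈ 𝔻.inner, (J.children.card - 1) + 𝔻.inner.card := by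
    rw [Finset.card_eq_sum_ones, ← Finset.sum_add_distrib]
    exact Finset.sum_congr rfl fun J hJ =>
      (Nat.sub_add_cancel (one_le_two.trans (Node.two_le_card_children hJ))).symm
  have h_nodes := 𝔻.sum_card_children_add_card_roots
  have h_inner := 𝔻.card_add_card_inner
  omega

theorem card_eq_iff_isBinary (hn : n ≠ 0) :
    𝔻.D.card = 2 * n - 1 ↔ 𝔻.roots.card = 1 ∧ 𝔻.IsBinary := by
  have h_roots : 0 < 𝔻.roots.card := (𝔻.roots_nonempty hn).card_pos
  have h_inner := 𝔻.card_add_card_inner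
  have h_sum := 𝔻.sum_card_children_sub_one_add_card_roots
  have h_one_le (J) (hJ : J ∈ 𝔻.inner) : 1 ≤ J.children.card - 1 :=
    Nat.le_sub_one_of_lt (Node.two_le_card_children hJ)
  have h_le : ∑ J ∈ 𝔻.inner, 1 ≤ ∑ J ∈ 𝔻.inner, (J.children.card - 1) :=
    Finset.sum_le_sum h_one_le
  have h_iff : ∑ J ∈ 𝔻.inner, 1 = ∑ J ∈ 𝔻.inner, (J.children.card - 1) ↔ 𝔻.IsBinary :=
    (Finset.sum_eq_sum_iff_of_le h_one_le).trans
      (forall₂_congr fun J hJ => by have := h_one_le J hJ; omega)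
  rw [← h_iff]
  rw [Fintype.card_coe] at h_inner
  rw [← Finset.card_eq_sum_ones] at *
  omega

theorem prod_card_children_eq (hn : n ≠ 0) (hD : 𝔻.D.card = 2 * n - 1) :
    ∏ J ∈ 𝔻.inner, J.children.card = 2 ^ (n - 1) := by
  have h_inner := 𝔻.card_add_card_inner
  rw [Fintype.card_coe] at h_inner
  rw [Finset.prod_congr rfl ((𝔻.card_eq_iff_isBinary hn).1 hD).2, Finset.prod_const]
  congr 1
  omega

theorem prod_card_children_lt (hn : n ≠ 0) (hD : 𝔻.D.card ≠ 2 * n - 1) :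
    ∏ J ∈ 𝔻.inner, J.children.card < 2 ^ (n - 1) := by
  have h_roots : 0 < 𝔻.roots.card := (𝔻.roots_nonempty hn).card_pos
  have h_sum := 𝔻.sum_card_children_sub_one_add_card_roots
  by_cases h_binary : 𝔻.IsBinary
  · have h_ne : 𝔻.roots.card ≠ 1 := fun h => hD ((𝔻.card_eq_iff_isBinary hn).2 ⟨h, h_binary⟩)
    calc ∏ J ∈ 𝔻.inner, J.children.card ≤ 2 ^ ∑ J ∈ 𝔻.inner, (J.children.card - 1) :=
          prod_le_two_pow_sum_sub_one _ _
      _ < 2 ^ (n - 1) := Nat.pow_lt_pow_right (by norm_num) (by omega)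
  · rw [IsBinary] at h_binary
    push Not at h_binary
    calc ∏ J ∈ 𝔻.inner, J.children.card < 2 ^ ∑ J ∈ 𝔻.inner, (J.children.card - 1) :=
          prod_lt_two_pow_sum_sub_one (fun _ => Node.two_le_card_children) h_binary
      _ ≤ 2 ^ (n - 1) := Nat.pow_le_pow_right (by norm_num) (by omega)

end Tree

end SpecialDatum

namespace SpecialDatum

variable {n : ℕ} {𝔻 : SpecialDatum n}

open Finsupp (single linearCombination)

section Exponent

variable (𝔻) in
/-- The exponent vector of the generator `x_J ^ w(J)` of `R_𝔻`. -/
def exponent (J : 𝔻.Node) : Fin n →₀ ℕ :=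
  𝔻.w J.1 • ∑ j ∈ J.1, single j 1

theorem exponent_apply (J : 𝔻.Node) (i : Fin n) :
    𝔻.exponent J i = if i ∈ J.1 then 𝔻.w J.1 else 0 := by
  simp [exponent, Finsupp.single_apply]

theorem linearCombination_exponent_apply (m : 𝔻.Node →₀ ℕ) (i : Fin n) :
    linearCombination ℕ 𝔻.exponent m i = ∑ J with i ∈ J.1, m J * 𝔻.w J.1 := by
  rw [Finsupp.linearCombination_apply,
    Finsupp.sum_fintype m (fun J c => c • 𝔻.exponent J) fun _ => zero_smul ℕ _,
    Finsupp.finsetSum_apply, Finset.sum_filter]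
  exact Finset.sum_congr rfl fun J _ => by
    rw [Finsupp.smul_apply, exponent_apply, smul_eq_mul, mul_ite, mul_zero]

theorem mul_w_le_linearCombination_exponent (m : 𝔻.Node →₀ ℕ) {J : 𝔻.Node} {i : Fin n}
    (hi : i ∈ J.1) : m J * 𝔻.w J.1 ≤ linearCombination ℕ 𝔻.exponent m i := by
  rw [linearCombination_exponent_apply]
  exact Finset.single_le_sum (f := fun J : 𝔻.Node => m J * 𝔻.w J.1) (fun _ _ => Nat.zero_le _)
    (by simpa using hi)

theorem exponent_ne_zero (J : 𝔻.Node) : 𝔻.exponent J ≠ 0 := by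
  obtain ⟨i, hi⟩ := 𝔻.nonempty_of_mem J.1 J.2
  refine Finsupp.ne_iff.2 ⟨i, ?_⟩
  rw [exponent_apply, if_pos hi]
  exact (𝔻.w_pos J.2).ne'

/-- No generator of `R_𝔻` is a product of other ones, since weights decrease along inclusions. -/
theorem eq_single_of_linearCombination_eq_exponent {m : 𝔻.Node →₀ ℕ} {J : 𝔻.Node}
    (hm : linearCombination ℕ 𝔻.exponent m = 𝔻.exponent J) : m = single J 1 := by
  have h_pos (K : 𝔻.Node) (hK : m K ≠ 0) : K = J := by
    have h_le {i} (hi : i ∈ K.1) : m K * 𝔻.w K.1 ≤ 𝔻.exponent J i :=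
      hm ▸ mul_w_le_linearCombination_exponent m hi
    have h_w : 𝔻.w K.1 ≤ m K * 𝔻.w K.1 := Nat.le_mul_of_pos_left _ (Nat.pos_of_ne_zero hK)
    have h_subset : K ≤ J := by
      intro i hi
      by_contra hiJ
      have h_zero := h_w.trans (h_le hi)
      rw [exponent_apply, if_neg hiJ] at h_zero
      exact (𝔻.w_pos K.2).not_ge h_zero
    refine h_subset.eq_of_not_lt fun h_lt => ?_
    obtain ⟨i, hi⟩ := 𝔻.nonempty_of_mem K.1 K.2
    have h_ge := h_w.trans (h_le hi)
    rw [exponent_apply, if_pos (h_subset hi)] at h_ge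
    exact (𝔻.w_lt K.1 K.2 J.1 J.2 h_lt).not_ge h_ge
  obtain ⟨c, rfl⟩ : ∃ c, m = single J c :=
    ⟨m J, (Finsupp.support_subset_singleton.1 fun K hK =>
      Finset.mem_singleton.2 (h_pos K (Finsupp.mem_support_iff.1 hK)))⟩
  obtain ⟨i, hi⟩ := 𝔻.nonempty_of_mem J.1 J.2
  have h_apply := DFunLike.congr_fun hm i
  rw [Finsupp.linearCombination_single, Finsupp.smul_apply, exponent_apply, if_pos hi,
    smul_eq_mul] at h_apply
  rw [(Nat.mul_eq_right (𝔻.w_pos J.2).ne').1 h_apply]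

end Exponent

section NormalForm

theorem Node.sum_children {M : Type*} [AddCommMonoid M] {J : 𝔻.Node} (hJ : J ∈ 𝔻.inner)
    (f : Fin n → M) : ∑ K ∈ J.children, ∑ j ∈ K.1, f j = ∑ j ∈ J.1, f j := by
  have h_biUnion : J.children.biUnion Subtype.val = J.1 := by
    refine Finset.Subset.antisymm
      (Finset.biUnion_subset.2 fun K hK => (mem_children.1 hK).le) fun i hi => ?_
    obtain ⟨K, hK, hiK⟩ := exists_mem_children hJ hi
    exact Finset.mem_biUnion.2 ⟨K, hK, hiK⟩
  rw [← h_biUnion, Finset.sum_biUnion]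
  intro K hK L hL h_ne
  exact Finset.disjoint_left.2 fun i hiK hiL =>
    h_ne (eq_of_covBy_of_mem (mem_children.1 hK) (mem_children.1 hL) hiK hiL)

theorem Node.exists_w_eq_mul {J : 𝔻.Node} (hJ : J ∈ 𝔻.inner) :
    ∃ c, 2 ≤ c ∧ ∀ K ∈ J.children, 𝔻.w K.1 = c * 𝔻.w J.1 := by
  obtain ⟨K, hK⟩ := mem_inner.1 hJ
  have hKJ : K ⋖ J := mem_children.1 hK
  obtain ⟨c, hc⟩ := 𝔻.w_dvd K.1 K.2 J.1 J.2 hKJ.lt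
  have h_lt : 1 * 𝔻.w J.1 < c * 𝔻.w J.1 := by
    rw [one_mul, mul_comm, ← hc]
    exact 𝔻.w_lt K.1 K.2 J.1 J.2 hKJ.lt
  exact ⟨c, Nat.lt_of_mul_lt_mul_right h_lt, fun L hL => by
    rw [w_eq_of_covBy (mem_children.1 hL) hKJ, hc, mul_comm]⟩

/-- The exponents, in terms of the generators `y_J = x_J ^ w(J)`, of the monomial
`∏ y_K` over the children `K` of `J`. -/
def childrenVector (J : 𝔻.Node) : 𝔻.Node →₀ ℕ :=
  ∑ K ∈ J.children, single K 1

theorem childrenVector_apply [DecidableEq 𝔻.Node] (J K : 𝔻.Node) :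
    childrenVector J K = if K ∈ J.children then 1 else 0 := by
  simp [childrenVector, Finsupp.finsetSum_apply, Finsupp.single_apply]

theorem support_childrenVector (J : 𝔻.Node) : (childrenVector J).support = J.children := by
  classical
  ext K
  simp [childrenVector_apply]

theorem degree_childrenVector (J : 𝔻.Node) : (childrenVector J).degree = J.children.card := by
  simp [childrenVector]

/-- The relation `∏ y_K = y_J ^ c`, over the children `K` of `J`, between the generators
`y_J = x_J ^ w(J)`. -/
theorem exists_linearCombination_childrenVector {J : 𝔻.Node} (hJ : J ∈ 𝔻.inner) :
    ∃ c, 2 ≤ c ∧ linearCombination ℕ 𝔻.exponent (childrenVector J) =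
      linearCombination ℕ 𝔻.exponent (single J c) := by
  obtain ⟨c, hc, hw⟩ := Node.exists_w_eq_mul hJ
  refine ⟨c, hc, ?_⟩
  calc linearCombination ℕ 𝔻.exponent (childrenVector J)
      = ∑ K ∈ J.children, 𝔻.w K.1 • ∑ j ∈ K.1, single j 1 := by
        simp [childrenVector, exponent]
    _ = (c * 𝔻.w J.1) • ∑ j ∈ J.1, single j 1 := by
        rw [← Node.sum_children hJ, Finset.smul_sum]
        exact Finset.sum_congr rfl fun K hK => by rw [hw K hK]
    _ = linearCombination ℕ 𝔻.exponent (single J c) := by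
        rw [Finsupp.linearCombination_single, exponent, smul_smul]

variable (𝔻) in
/-- The exponents, in terms of the generators of `R_𝔻`, of the monomials that omit at least one
child of every inner member. -/
def normal : Set (𝔻.Node →₀ ℕ) :=
  standard 𝔻.inner childrenVector

/-- The potential `∑ m J * |J|` increases when the children of a member are replaced by a power of
that member. -/
theorem exists_lt_of_notMem_normal {m : 𝔻.Node →₀ ℕ} (hm : m ∉ 𝔻.normal) :
    ∃ m', linearCombination ℕ 𝔻.exponent m' = linearCombination ℕ 𝔻.exponent m ∧
      (𝔻.IsBinary → m.degree ≤ m'.degree) ∧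
      linearCombination ℕ (fun J : 𝔻.Node => J.1.card) m <
        linearCombination ℕ (fun J : 𝔻.Node => J.1.card) m' := by
  obtain ⟨J, hJ, hJm⟩ : ∃ J ∈ 𝔻.inner, childrenVector J ≤ m := by simpa [normal, standard] using hm
  obtain ⟨a, rfl⟩ := exists_add_of_le hJm
  obtain ⟨c, hc, h_rel⟩ := exists_linearCombination_childrenVector hJ
  refine ⟨single J c + a, by rw [map_add, map_add, h_rel], fun h_binary => ?_, ?_⟩
  · rw [map_add, map_add, degree_childrenVector, h_binary J hJ, Finsupp.degree_single]
    exact Nat.add_le_add_right hc _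
  · have h_card : ∑ K ∈ J.children, K.1.card = J.1.card := by
      simpa only [Finset.card_eq_sum_ones] using Node.sum_children hJ fun _ => 1
    have h_pos : 0 < J.1.card := (𝔻.nonempty_of_mem J.1 J.2).card_pos
    simp only [childrenVector, map_add, map_sum, Finsupp.linearCombination_single, smul_eq_mul,
      one_mul, h_card, add_lt_add_iff_right]
    nlinarith

theorem exists_mem_normal (m : 𝔻.Node →₀ ℕ) :
    ∃ m' ∈ 𝔻.normal, linearCombination ℕ 𝔻.exponent m' = linearCombination ℕ 𝔻.exponent m ∧
      (𝔻.IsBinary → m.degree ≤ m'.degree) := by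
  obtain ⟨b, ⟨hb, hb_deg⟩, hb_max⟩ := Set.exists_max_image
    {m' | linearCombination ℕ 𝔻.exponent m' = linearCombination ℕ 𝔻.exponent m ∧
      (𝔻.IsBinary → m.degree ≤ m'.degree)}
    (linearCombination ℕ fun J : 𝔻.Node => J.1.card)
    ((finite_setOf_linearCombination_eq exponent_ne_zero _).subset fun _ h => h.1)
    ⟨m, rfl, fun _ => le_rfl⟩
  refine ⟨b, by_contra fun h_notMem => ?_, hb, hb_deg⟩
  obtain ⟨m', hm', hm'_deg, h_lt⟩ := exists_lt_of_notMem_normal h_notMem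
  exact (hb_max m' ⟨hm'.trans hb, fun h => (hb_deg h).trans (hm'_deg h)⟩).not_gt h_lt

open Classical in
/-- The part of the exponents of a monomial in `x_1, …, x_n` that comes from the generators
`x_K ^ w(K)` with `J ⊆ K`; it is the same for all variables indexed by `J`. -/
def aboveSum (m : 𝔻.Node →₀ ℕ) (J : 𝔻.Node) : ℕ :=
  ∑ K with J ≤ K, m K * 𝔻.w K.1

theorem aboveSum_le (m : 𝔻.Node →₀ ℕ) {J : 𝔻.Node} {i : Fin n} (hi : i ∈ J.1) :
    aboveSum m J ≤ linearCombination ℕ 𝔻.exponent m i := by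
  rw [linearCombination_exponent_apply, aboveSum]
  refine Finset.sum_le_sum_of_subset fun K hK => ?_
  rw [Finset.mem_filter_univ] at hK ⊢
  exact hK hi

theorem aboveSum_eq_of_covBy {m : 𝔻.Node →₀ ℕ} {K J : 𝔻.Node} (hKJ : K ⋖ J) (hK : m K = 0) :
    aboveSum m K = aboveSum m J := by
  rw [aboveSum, aboveSum]
  refine (Finset.sum_subset (fun L hL => ?_) fun L hL hLJ => ?_).symm <;>
    rw [Finset.mem_filter_univ] at *
  · exact hKJ.le.trans hL
  · rcases hL.eq_or_lt with rfl | hKL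
    · rw [hK, zero_mul]
    · exact absurd (Node.le_of_covBy_of_lt hKJ hKL) hLJ

theorem exists_eq_aboveSum {m : 𝔻.Node →₀ ℕ} (hm : m ∈ 𝔻.normal) (J : 𝔻.Node) :
    ∃ i ∈ J.1, linearCombination ℕ 𝔻.exponent m i = aboveSum m J := by
  classical
  induction J using WellFoundedLT.induction with
  | ind J ih =>
  by_cases hJ : J ∈ 𝔻.inner
  · obtain ⟨K, hK, hmK⟩ : ∃ K ∈ J.children, m K = 0 := by
      obtain ⟨K, hK⟩ := not_forall.1 (hm J hJ)
      by_cases hKJ : K ∈ J.children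
      · exact ⟨K, hKJ, by simpa [childrenVector_apply, hKJ] using hK⟩
      · simp [childrenVector_apply, hKJ] at hK
    obtain ⟨i, hi, h_eq⟩ := ih K (Node.mem_children.1 hK).lt
    exact ⟨i, (Node.mem_children.1 hK).le hi,
      h_eq.trans (aboveSum_eq_of_covBy (Node.mem_children.1 hK) hmK)⟩
  · obtain ⟨i, hi⟩ := notMem_inner_iff.1 hJ
    refine ⟨i, hi ▸ Finset.mem_singleton_self i, ?_⟩
    simp only [linearCombination_exponent_apply, aboveSum, ← Subtype.coe_le_coe, hi,
      Finset.singleton_subset_iff]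

open Classical in
theorem aboveSum_eq_add (m : 𝔻.Node →₀ ℕ) (J : 𝔻.Node) :
    aboveSum m J = m J * 𝔻.w J.1 + ∑ K with J < K, m K * 𝔻.w K.1 := by
  have h_insert : ({K | J ≤ K} : Finset 𝔻.Node) = insert J ({K | J < K} : Finset 𝔻.Node) := by
    ext K
    simp [le_iff_eq_or_lt, eq_comm]
  rw [aboveSum, h_insert, Finset.sum_insert (by simp)]

theorem aboveSum_injective : Function.Injective (aboveSum : (𝔻.Node →₀ ℕ) → 𝔻.Node → ℕ) := by
  intro a b hab
  ext J
  induction J using WellFoundedGT.induction with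
  | ind J ih =>
  have h_eq := congrFun hab J
  rw [aboveSum_eq_add, aboveSum_eq_add,
    Finset.sum_congr rfl fun K hK => by rw [ih K ((Finset.mem_filter_univ K).1 hK)]] at h_eq
  exact Nat.eq_of_mul_eq_mul_right (𝔻.w_pos J.2) (Nat.add_right_cancel h_eq)

/-- For a normal `m`, the value of `aboveSum m` at `J` is the minimum over `J` of the exponents of
the corresponding monomial in `x_1, …, x_n`. -/
theorem injOn_linearCombination_normal : Set.InjOn (linearCombination ℕ 𝔻.exponent) 𝔻.normal := by
  have h_le {a b} (hb : b ∈ 𝔻.normal)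
      (hab : linearCombination ℕ 𝔻.exponent a = linearCombination ℕ 𝔻.exponent b) (J : 𝔻.Node) :
      aboveSum a J ≤ aboveSum b J := by
    obtain ⟨i, hi, h_eq⟩ := exists_eq_aboveSum hb J
    rw [← h_eq, ← hab]
    exact aboveSum_le a hi
  exact fun a ha b hb hab => aboveSum_injective (le_antisymm (h_le hb hab) (h_le ha hab.symm))

variable (𝔻)

theorem ncard_orderLT_le_degreeCount_normal (k : ℕ) :
    (orderLT 𝔻.exponent k).ncard ≤ degreeCount 𝔻.normal k := by
  have h_finite := finite_setOf_mem_degree_lt 𝔻.normal k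
  refine (Set.ncard_le_ncard (fun s hs => ?_) (h_finite.image _)).trans
    (Set.ncard_image_le (f := linearCombination ℕ 𝔻.exponent) h_finite)
  obtain ⟨⟨m, rfl⟩, h_lt⟩ := mem_orderLT.1 hs
  obtain ⟨b, hb, h_eq, -⟩ := exists_mem_normal m
  exact ⟨b, ⟨hb, h_lt b h_eq⟩, h_eq⟩

variable {𝔻} in
theorem IsBinary.ncard_orderLT_eq_degreeCount_normal (h𝔻 : 𝔻.IsBinary) (k : ℕ) :
    (orderLT 𝔻.exponent k).ncard = degreeCount 𝔻.normal k := by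
  refine (𝔻.ncard_orderLT_le_degreeCount_normal k).antisymm (Set.ncard_le_ncard_of_injOn
    (linearCombination ℕ 𝔻.exponent) (fun m hm => mem_orderLT.2 ⟨⟨m, rfl⟩, fun m' h_eq => ?_⟩)
    (injOn_linearCombination_normal.mono fun _ h => h.1) (finite_orderLT _ k))
  obtain ⟨b, hb, hbm', h_deg⟩ := exists_mem_normal m'
  obtain rfl := injOn_linearCombination_normal hb hm.1 (hbm'.trans h_eq)
  exact (h_deg h𝔻).trans_lt hm.2

theorem exists_eventuallyEqPoly_degreeCount_normal :
    ∃ p, EventuallyEqPoly (degreeCount 𝔻.normal) p ∧ p.natDegree ≤ n ∧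
      n.factorial * p.coeff n = ∏ J ∈ 𝔻.inner, (J.children.card : ℝ) := by
  simp only [← degree_childrenVector]
  refine exists_eventuallyEqPoly_degreeCount_standard_of_disjoint (fun J hJ L hL h_ne => ?_)
    𝔻.card_add_card_inner
  refine Finsupp.disjoint_iff.2 ?_
  rw [support_childrenVector, support_childrenVector]
  exact pairwise_disjoint_children hJ hL h_ne

theorem exists_tendsto_ncard_orderLT :
    ∃ x : ℝ, Tendsto (fun k => n.factorial * ((orderLT 𝔻.exponent k).ncard : ℝ) / k ^ n) atTop
        (𝓝 x) ∧
      x ≤ ∏ J ∈ 𝔻.inner, J.children.card ∧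
      (𝔻.IsBinary → x = ∏ J ∈ 𝔻.inner, J.children.card) := by
  obtain ⟨p, hp⟩ := exists_eventuallyEqPoly_ncard_orderLT (a := 𝔻.exponent) exponent_ne_zero
  obtain ⟨q, hq, hq_deg, hq_coeff⟩ := 𝔻.exists_eventuallyEqPoly_degreeCount_normal
  have hp_deg : p.natDegree ≤ n :=
    (hp.natDegree_le_of_le hq 𝔻.ncard_orderLT_le_degreeCount_normal).trans hq_deg
  have hp_lim := hp.tendsto_div_pow hp_deg
  have hq_lim := hq.tendsto_div_pow hq_deg
  push_cast
  refine ⟨n.factorial * p.coeff n, by simpa only [mul_div_assoc] using hp_lim.const_mul _, ?_, ?_⟩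
  · rw [← hq_coeff]
    gcongr
    refine le_of_tendsto_of_tendsto' hp_lim hq_lim fun k => ?_
    gcongr
    exact 𝔻.ncard_orderLT_le_degreeCount_normal k
  · intro h𝔻
    simp only [h𝔻.ncard_orderLT_eq_degreeCount_normal] at hp_lim
    rw [← hq_coeff, tendsto_nhds_unique hp_lim hq_lim]

end NormalForm

end SpecialDatum

section Length

open IsLocalRing

theorem length_eq_length_of_residueField_surjective {K A : Type*} [Field K] [CommRing A]
    [IsLocalRing A] [Algebra K A] (hK : Function.Surjective (algebraMap K (ResidueField A)))
    (M : Type*) [AddCommGroup M] [Module A M] [Module K M] [IsScalarTower K A M] :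
    Module.length A M = Module.length K M := by
  have h_surjective : Function.Surjective (algebraMap (ResidueField K) (ResidueField A)) :=
    Function.Surjective.of_comp (g := residue K) hK
  rw [length_restrictScalars K A M, Module.length_eq_of_surjective h_surjective,
    Module.length_eq_one (ResidueField A), mul_one]

theorem length_quotient_maximalIdeal_pow {K R A : Type*} [Field K] [CommRing R] [Algebra K R]
    (p : Ideal R) [p.IsMaximal] [CommRing A] [IsLocalRing A] [Algebra R A]
    [IsLocalization.AtPrime A p] (hp : Function.Surjective (algebraMap K (R ⧸ p))) (k : ℕ) :
    Module.length A (A ⧸ maximalIdeal A ^ k) = Module.length K (R ⧸ p ^ k) := by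
  let _ : Algebra K A := ((algebraMap R A).comp (algebraMap K R)).toAlgebra
  have : IsScalarTower K R A := IsScalarTower.of_algebraMap_eq fun _ => rfl
  have hK : Function.Surjective (algebraMap K (ResidueField A)) := by
    intro x
    obtain ⟨y, rfl⟩ := (IsLocalization.AtPrime.equivQuotMaximalIdeal p A).surjective x
    obtain ⟨c, rfl⟩ := hp y
    refine ⟨c, ?_⟩
    rw [IsScalarTower.algebraMap_apply K R (R ⧸ p), Ideal.Quotient.algebraMap_eq,
      IsLocalization.AtPrime.equivQuotMaximalIdeal_apply_mk]
    rfl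
  rw [length_eq_length_of_residueField_surjective hK]
  exact ((IsLocalization.AtPrime.equivQuotMaximalIdealPow p A k).toLinearEquiv.restrictScalars
    K).length_eq.symm

theorem embeddingDimension_eq_toNat_length (A : Type*) [CommRing A] [IsLocalRing A] :
    embeddingDimension A = (Module.length A (CotangentSpace A)).toNat := by
  rw [Module.length_eq_of_surjective (R := ResidueField A) residue_surjective,
    Module.length_eq_rank, Cardinal.toNat_toENat]
  rfl

theorem length_cotangentSpace_add_one (A : Type*) [CommRing A] [IsLocalRing A] :
    Module.length A (CotangentSpace A) + 1 = Module.length A (A ⧸ maximalIdeal A ^ 2) := by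
  set I := maximalIdeal A
  have hI : I ^ 2 ≤ I := Ideal.pow_le_self two_ne_zero
  have h_exact : Function.Exact I.cotangentToQuotientSquare (Submodule.factor hI) := by
    rw [LinearMap.exact_iff, Ideal.range_cotangentToQuotientSquare, Submodule.factor,
      Submodule.mapQ, Submodule.ker_liftQ, LinearMap.comp_id, Submodule.ker_mkQ]
    rfl
  have h_residueField : Module.length A (A ⧸ I) = 1 :=
    Module.length_eq_one_iff.2 (isSimpleModule_iff_isCoatom.2 (maximalIdeal.isMaximal A).out)
  rw [← h_residueField]
  exact (Module.length_eq_add_of_exact _ _ I.cotangentToQuotientSquare_injective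
    (Submodule.factor_surjective hI) h_exact).symm

end Length

section Dimension

variable {R S : Type*} [CommRing R] [CommRing S] [Algebra R S] [Algebra.IsIntegral R S]

theorem ringKrullDim_le_of_isIntegral [FaithfulSMul R S] : ringKrullDim R ≤ ringKrullDim S := by
  refine iSup_le fun l => ?_
  obtain ⟨⟨Q, hQ, hQl⟩⟩ := Ideal.nonempty_primesOver (S := S) l.head.asIdeal
  obtain ⟨L, hL, -⟩ := Ideal.exists_ltSeries_of_hasGoingUp l Q
  rw [← hL]
  exact le_iSup (fun p : LTSeries (PrimeSpectrum S) => (p.length : WithBot ℕ∞)) L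

theorem height_le_height_comap_of_isIntegral (P : Ideal S) [hP : P.IsPrime] :
    P.height ≤ (P.comap (algebraMap R S)).height := by
  have h := Order.height_le_height_apply_of_strictMono (PrimeSpectrum.comap (algebraMap R S))
    (fun _ _ h => Ideal.IsIntegral.comap_lt_comap h) ⟨P, hP⟩
  rwa [← PrimeSpectrum.height_eq_orderHeight, ← PrimeSpectrum.height_eq_orderHeight] at h

end Dimension

section CoordinatePrime

open MvPolynomial

variable {σ K : Type*} [Field K]

variable (K) in
/-- The substitution that sends the variables in `S` to zero. -/
def killVars (S : Set σ) : MvPolynomial σ K →ₐ[K] MvPolynomial σ K :=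
  aeval (Sᶜ.indicator X)

theorem killVars_X_of_mem {S : Set σ} {i : σ} (hi : i ∈ S) : killVars K S (X i) = 0 := by
  rw [killVars, aeval_X, Set.indicator_of_notMem (not_not.2 hi)]

theorem killVars_X_of_notMem {S : Set σ} {i : σ} (hi : i ∉ S) : killVars K S (X i) = X i := by
  rw [killVars, aeval_X, Set.indicator_of_mem hi]

theorem killVars_comp_killVars {S T : Set σ} (hST : S ⊆ T) :
    (killVars K T).comp (killVars K S) = killVars K T := by
  ext1 i
  rw [AlgHom.comp_apply]
  by_cases hi : i ∈ S
  · rw [killVars_X_of_mem hi, killVars_X_of_mem (hST hi), map_zero]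
  · rw [killVars_X_of_notMem hi]

theorem killVars_univ (p : MvPolynomial σ K) : killVars K Set.univ p = C (constantCoeff p) := by
  rw [killVars, Set.compl_univ, Set.indicator_empty']
  exact aeval_zero p

variable (K) in
/-- The prime ideal of the polynomials that vanish where the variables in `S` do. -/
def coordinatePrime (S : Set σ) : PrimeSpectrum (MvPolynomial σ K) :=
  ⟨RingHom.ker (killVars K S), RingHom.ker_isPrime _⟩

theorem coordinatePrime_strictMono : StrictMono (coordinatePrime K (σ := σ)) := by
  intro S T hST
  obtain ⟨h_subset, i, hiT, hiS⟩ := Set.ssubset_iff_exists.1 hST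
  refine PrimeSpectrum.asIdeal_lt_asIdeal _ _ |>.1 <|
    SetLike.lt_iff_le_and_exists.2 ⟨fun p hp => ?_, X i, killVars_X_of_mem hiT, fun hi => ?_⟩
  · change killVars K T p = 0
    rw [← killVars_comp_killVars h_subset, AlgHom.comp_apply, (hp : killVars K S p = 0), map_zero]
  · exact X_ne_zero i ((killVars_X_of_notMem hiS).symm.trans hi)

variable (K) in
theorem le_height_ker_constantCoeff (n : ℕ) :
    n ≤ (RingHom.ker (constantCoeff (R := K) (σ := Fin n))).height := by
  let flag : LTSeries (Set (Fin n)) :=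
    { length := n
      toFun := fun k => {i | i.castSucc < k}
      step := fun k => Set.ssubset_iff_exists.2
        ⟨fun i hi => hi.trans k.castSucc_lt_succ, k, k.castSucc_lt_succ, lt_irrefl k.castSucc⟩ }
  have h_last :
      coordinatePrime K flag.last = ⟨RingHom.ker constantCoeff, RingHom.ker_isPrime _⟩ := by
    have h_univ : flag.last = Set.univ := Set.eq_univ_of_forall Fin.castSucc_lt_last
    ext p
    change killVars K flag.last p = 0 ↔ constantCoeff p = 0
    rw [h_univ, killVars_univ, C_eq_zero]
  have h := Order.length_le_height_last (p := flag.map _ (coordinatePrime_strictMono (K := K)))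
  rwa [LTSeries.last_map, h_last, ← PrimeSpectrum.height_eq_orderHeight] at h

end CoordinatePrime

namespace SpecialDatum

variable {n : ℕ} (𝔻 : SpecialDatum n)

theorem monomial_eq (J : 𝔻.Node) :
    𝔻.monomial J.1 = MvPolynomial.monomial (𝔻.exponent J) 1 := by
  rw [monomial, exponent, ← one_pow (M := ℂ) (𝔻.w J.1), ← MvPolynomial.monomial_pow,
    MvPolynomial.monomial_sum_one]
  rfl

theorem ring_eq_adjoin_range :
    𝔻.ring = Algebra.adjoin ℂ (Set.range fun J => MvPolynomial.monomial (𝔻.exponent J) 1) := by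
  simp only [← monomial_eq, ring, Set.range, Subtype.exists, exists_prop, eq_comm]

theorem maxIdeal_eq_span :
    𝔻.maxIdeal = Ideal.span {r : 𝔻.ring | ∃ J, (r : MvPolynomial (Fin n) ℂ) =
      MvPolynomial.monomial (𝔻.exponent J) 1} := by
  simp only [← monomial_eq, maxIdeal, Subtype.exists, exists_prop]

instance isIntegral_ring : Algebra.IsIntegral 𝔻.ring (MvPolynomial (Fin n) ℂ) := by
  refine ⟨fun p => ?_⟩
  induction p using MvPolynomial.induction_on with
  | C a => exact isIntegral_algebraMap (x := algebraMap ℂ 𝔻.ring a)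
  | add p q hp hq => exact hp.add hq
  | mul_X p i hp =>
    refine hp.mul (IsIntegral.of_pow (𝔻.w_pos (𝔻.singleton_mem i)) ?_)
    have h_mem : MvPolynomial.X i ^ 𝔻.w {i} ∈ 𝔻.ring :=
      Algebra.subset_adjoin ⟨{i}, 𝔻.singleton_mem i, by rw [monomial, Finset.prod_singleton]⟩
    exact isIntegral_algebraMap (x := (⟨_, h_mem⟩ : 𝔻.ring))

theorem evalZero_algebraMap (c : ℂ) : 𝔻.evalZero (algebraMap ℂ 𝔻.ring c) = c :=
  MvPolynomial.constantCoeff_C (Fin n) c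

instance maxIdeal_isMaximal : 𝔻.maxIdeal.IsMaximal := by
  rw [maxIdeal_eq_ker]
  exact RingHom.ker_isMaximal_of_surjective _ fun c => ⟨_, 𝔻.evalZero_algebraMap c⟩

theorem algebraMap_quotient_maxIdeal_surjective :
    Function.Surjective (algebraMap ℂ (𝔻.ring ⧸ 𝔻.maxIdeal)) := by
  refine Ideal.Quotient.mk_surjective.forall.2 fun r => ⟨𝔻.evalZero r, ?_⟩
  rw [IsScalarTower.algebraMap_apply ℂ 𝔻.ring, Ideal.Quotient.algebraMap_eq, Ideal.Quotient.eq,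
    maxIdeal_eq_ker, RingHom.mem_ker, map_sub, evalZero_algebraMap, sub_self]

theorem height_maxIdeal : 𝔻.maxIdeal.height = n := by
  apply le_antisymm
  · have h_height := Ideal.height_le_ringKrullDim_of_ne_top 𝔻.maxIdeal_isPrime.ne_top
    have h_dim := ringKrullDim_le_of_isIntegral (R := 𝔻.ring) (S := MvPolynomial (Fin n) ℂ)
    rw [MvPolynomial.ringKrullDim_of_isNoetherianRing, ringKrullDim_eq_zero_of_field, zero_add,
      Nat.card_fin] at h_dim
    exact_mod_cast h_height.trans h_dim
  · rw [maxIdeal_eq_ker]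
    exact (le_height_ker_constantCoeff ℂ n).trans
      (height_le_height_comap_of_isIntegral (R := 𝔻.ring) _ (hP := RingHom.ker_isPrime _))

section Localization

variable (A : Type*) [CommRing A] [IsLocalRing A] [Algebra 𝔻.ring A]
  [IsLocalization.AtPrime A 𝔻.maxIdeal]

theorem length_quotient_maximalIdeal_pow_eq_encard (k : ℕ) :
    Module.length A (A ⧸ IsLocalRing.maximalIdeal A ^ k) = (orderLT 𝔻.exponent k).encard := by
  obtain ⟨e⟩ := nonempty_quotient_pow_equiv 𝔻.ring_eq_adjoin_range 𝔻.maxIdeal_eq_span k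
  rw [length_quotient_maximalIdeal_pow 𝔻.maxIdeal 𝔻.algebraMap_quotient_maxIdeal_surjective,
    e.length_eq, Module.length_finsupp, Module.length_eq_one, mul_one, Set.encard]

theorem normalizedHilbertSamuel_eq (k : ℕ) :
    normalizedHilbertSamuel A k = n.factorial * ((orderLT 𝔻.exponent k).ncard : ℝ) / k ^ n := by
  have h_dim : ringKrullDim A = n := by
    rw [IsLocalization.AtPrime.ringKrullDim_eq_height 𝔻.maxIdeal, height_maxIdeal]
    rfl
  rw [normalizedHilbertSamuel, 𝔻.length_quotient_maximalIdeal_pow_eq_encard, h_dim]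
  rfl

theorem embeddingDimension_eq_card : embeddingDimension A = 𝔻.D.card := by
  have h := length_cotangentSpace_add_one A
  rw [𝔻.length_quotient_maximalIdeal_pow_eq_encard, ← (finite_orderLT _ 2).cast_ncard_eq,
    ncard_orderLT_two fun _ _ => eq_single_of_linearCombination_eq_exponent, Fintype.card_coe,
    Nat.cast_add, Nat.cast_one] at h
  rw [embeddingDimension_eq_toNat_length, WithTop.add_right_cancel ENat.one_ne_top h,
    ENat.toNat_natCast]

end Localization

end SpecialDatum

end

/-- The first conjunct says that the limit defining `e(R_𝔻)` exists. -/
theorem mainTheorem9 (n : ℕ) (hn : 1 ≤ n) (𝔻 : SpecialDatum n) :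
    Filter.Tendsto (normalizedHilbertSamuel 𝔻.LocalRing) Filter.atTop (nhds 𝔻.e) ∧
    𝔻.e ≤ 2 ^ (n - 1) ∧
    (𝔻.e = 2 ^ (n - 1) ↔ 𝔻.emb = 2 * n - 1) := by
  have hn' : n ≠ 0 := Nat.one_le_iff_ne_zero.1 hn
  obtain ⟨x, hx, h_le, h_eq⟩ := 𝔻.exists_tendsto_ncard_orderLT
  simp only [← 𝔻.normalizedHilbertSamuel_eq 𝔻.LocalRing] at hx
  rw [show 𝔻.e = x from hx.limUnder_eq,
    show 𝔻.emb = 𝔻.D.card from 𝔻.embeddingDimension_eq_card 𝔻.LocalRing]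
  by_cases hD : 𝔻.D.card = 2 * n - 1
  · have hx_eq : x = 2 ^ (n - 1) := by
      rw [h_eq ((𝔻.card_eq_iff_isBinary hn').1 hD).2]
      exact_mod_cast 𝔻.prod_card_children_eq hn' hD
    exact ⟨hx, hx_eq.le, iff_of_true hx_eq hD⟩
  · have hx_lt : x < 2 ^ (n - 1) :=
      h_le.trans_lt (by exact_mod_cast 𝔻.prod_card_children_lt hn' hD)
    exact ⟨hx, hx_lt.le, iff_of_false hx_lt.ne hD⟩
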